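/- Let $\Sigma$ be a finite nonempty alphabet. For strings $x,y$ over $\Sigma$ write $y \preceq x$ if $y$ is a (not necessarily contiguous) subsequence of $x$. For $L \in \mathbb{N}$, a \emph{randomized subsequence sketch} on a set $X$ of strings over $\Sigma$ is the following kind of one-way protocol. Alice, given $x \in X$, computes a bit string $\mathrm{sk}_L(x)$. Bob is given $\mathrm{sk}_L(x)$ and a string $y$ over $\Sigma$ of length at most $L$ and decides whether $y \preceq x$. Both may use (shared) random coins, and for every $x \in X$ and every $y$ of length at most $L$ Bob's answer is wrong with probability at most $1/3$. The protocol has worst-case size at least $s$ on $X$ if for some $x \in X$ the bit string $\mathrm{sk}_L(x)$ has length at least $s$ with positive probability. Theorem (one-sided randomized communication). There are constants $c > 0$ and $b \ge a > 0$, depending only on $|\Sigma|$, such that for all $L \ge 2$: (1) every randomized subsequence sketch on the set of all strings over $\Sigma$ has worst-case size at least $c\,L^{|\Sigma|-1}$, that is, $\Omega(L^{|\Sigma|-1})$; (2) this holds even restricted to strings of length $\Theta(L^{|\Sigma|-1})$: if $X$ is the set of all strings $x$ over $\Sigma$ with $a\,L^{|\Sigma|-1} \le |x| \le b\,L^{|\Sigma|-1}$,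 then every randomized subsequence sketch on $X$ has worst-case size at least $c\,L^{|\Sigma|-1}$ on $X$. -/

import Mathlib

open MeasureTheory

/-- A randomized (one-way) protocol for subsequence sketching over the alphabet `A`.
Alice holds a string `x` and sends a bit string `encode ω x`; Bob holds this message and a
string `y` and answers `decode ω _ y`. All coin tosses are collected in one outcome `ω : Ω`, which
both parties may read (shared randomness). Private coins are the special case where `Ω` is a
product and each party reads its own coordinate; deterministic protocols ignore `ω`.
The number `L` is known to both parties: a protocol is chosen for each `L` separately. -/
structure RandomizedSketch (A Ω : Type*) where
  encode : Ω → List A → List Bool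
  decode : Ω → List Bool → List A → Bool

namespace RandomizedSketch

variable {A Ω : Type*} [MeasurableSpace Ω]

/-- On every input string `x ∈ X` of Alice and every string `y` of length at most `L` of Bob, Bob's
decision whether `y` is a subsequence of `x` is wrong with probability at most `1/3`, when the
outcome of the coin tosses has law `μ`. (No measurability is imposed on the protocol; for an error
event that is not measurable, `μ` is its outer measure.) -/
def IsCorrectOn (S : RandomizedSketch A Ω) (μ : Measure Ω) (L : ℕ) (X : Set (List A)) : Prop :=
  ∀ x ∈ X, ∀ y : List A, y.length ≤ L →
    μ {ω | ¬ (S.decode ω (S.encode ω x) y = true ↔ y.Sublist x)} ≤ 1 / 3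

/-- The worst-case size over the inputs in `X` is at least `s`: for some input `x ∈ X` the sketch
has at least `s` bits with positive probability. -/
def SizeAtLeast (S : RandomizedSketch A Ω) (μ : Measure Ω) (X : Set (List A)) (s : ℝ) : Prop :=
  ∃ x ∈ X, 0 < μ {ω | s ≤ ((S.encode ω x).length : ℝ)}

end RandomizedSketch

/-! The proof reduces from the index problem. With `k + 1` letters, any subset `T` of the grid
`[l]^k` is encoded in a string of length of order `l ^ k`, and a query of length `k * l + 1` is a
subsequence exactly when its cell lies in `T`. Each dimension has its own closing letter. String and
query have equally many top-dimension closers, so these are matched one to one and pin the rest of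
the query inside one slice (`gridQuery_sublist_gridString_iff`). With `l` about `L / k`, a sketch
answers every bit of `m = l ^ k` arbitrary bits with error at most `1 / 3`.

Averaging fixes coins with mean error rate at most `1 / 3` over all pairs (bit vector, index).
Weight each vector by `2 ^ (-d)`, where `d` counts its wrong bits. By convexity the total weight is
at least `2 ^ m * 2 ^ (-m / 3)`, while each message accounts for at most `(3 / 2) ^ m`. Hence there
are at least `(32 / 27) ^ (m / 3)` messages, and some message has length of order `m`. -/

/-! ### Strings over `k + 1` letters that encode arbitrary subsets of a `k`-dimensional grid -/

section Gadget

variable {A : Type*}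

/-- The string that encodes the subset `T` of the grid `Fin k → Fin l`: the letter `f 0` occurs
at the cell `v` exactly if `v ∈ T`, and the letter `f j` closes the slices of dimension `j`. -/
def gridString (f : ℕ → A) (l : ℕ) : (k : ℕ) → ((Fin k → Fin l) → Bool) → List A
  | 0, T => if T Fin.elim0 then [f 0] else []
  | k + 1, T => (List.finRange l).flatMap fun i =>
      gridString f l k (fun v => T (Fin.cons i v)) ++ [f (k + 1)]

/-- The string that queries the cell `v` of a grid. -/
def gridQuery (f : ℕ → A) (l : ℕ) : (k : ℕ) → (Fin k → Fin l) → List A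
  | 0, _ => [f 0]
  | k + 1, v => List.replicate (v 0) (f (k + 1)) ++
      (gridQuery f l k (Fin.tail v) ++ List.replicate (l - v 0) (f (k + 1)))

theorem length_gridQuery (f : ℕ → A) (l k : ℕ) (v : Fin k → Fin l) :
    (gridQuery f l k v).length = k * l + 1 := by
  induction k with
  | zero => simp [gridQuery]
  | succ k ih =>
    have h := (v 0).isLt
    simp only [gridQuery, List.length_append, List.length_replicate, ih, Nat.succ_mul]
    omega

theorem mem_gridQuery (f : ℕ → A) (l k : ℕ) (v : Fin k → Fin l) {d : A}
    (hd : d ∈ gridQuery f l k v) : ∃ j ≤ k, d = f j := by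
  induction k with
  | zero => exact ⟨0, le_rfl, by simpa [gridQuery] using hd⟩
  | succ k ih =>
    simp only [gridQuery, List.mem_append, List.mem_replicate] at hd
    rcases hd with hd | hd | hd
    · exact ⟨k + 1, le_rfl, hd.2⟩
    · obtain ⟨j, hj, h⟩ := ih _ hd
      exact ⟨j, hj.trans k.le_succ, h⟩
    · exact ⟨k + 1, le_rfl, hd.2⟩

theorem mem_gridString (f : ℕ → A) (l k : ℕ) (T : (Fin k → Fin l) → Bool) {d : A}
    (hd : d ∈ gridString f l k T) : ∃ j ≤ k, d = f j := by
  induction k with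
  | zero =>
    refine ⟨0, le_rfl, ?_⟩
    unfold gridString at hd
    split_ifs at hd <;> simp_all
  | succ k ih =>
    simp only [gridString, List.mem_flatMap, List.mem_append, List.mem_singleton] at hd
    obtain ⟨i, -, hd | hd⟩ := hd
    · obtain ⟨j, hj, h⟩ := ih _ hd
      exact ⟨j, hj.trans k.le_succ, h⟩
    · exact ⟨k + 1, le_rfl, hd⟩

theorem length_gridString_le (f : ℕ → A) (l k : ℕ)
    (T : (Fin k → Fin l) → Bool) : (gridString f l k T).length ≤ (k + 1) * l ^ k := by
  induction k with
  | zero => unfold gridString; split_ifs <;> simp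
  | succ k ih =>
    simp only [gridString, List.length_flatMap, List.length_append, List.length_singleton]
    calc _ ≤ ((List.finRange l).map fun _ => (k + 1) * l ^ k + 1).sum :=
          List.sum_le_sum fun i _ => Nat.succ_le_succ (ih _)
      _ = (k + 1) * l ^ (k + 1) + l := by simp; ring
      _ ≤ (k + 1) * l ^ (k + 1) + l ^ (k + 1) := by
          gcongr; exact Nat.le_self_pow k.succ_ne_zero l
      _ = _ := by ring

/-- The closers of the lowest dimension alone number `l ^ k`, whatever `T` is. For `k = 0` this
fails: the empty subset gives the empty string. -/
theorem pow_le_length_gridString (f : ℕ → A) (l : ℕ) (k : ℕ) (hk : 1 ≤ k)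
    (T : (Fin k → Fin l) → Bool) : l ^ k ≤ (gridString f l k T).length := by
  induction k, hk using Nat.le_induction with
  | base =>
    simp only [gridString, List.length_flatMap, List.length_append, List.length_singleton]
    calc l ^ 1 = ((List.finRange l).map fun _ => 1).sum := by simp
      _ ≤ _ := List.sum_le_sum fun i _ => Nat.le_add_left _ _
  | succ k hk ih =>
    simp only [gridString, List.length_flatMap, List.length_append, List.length_singleton]
    calc l ^ (k + 1) = ((List.finRange l).map fun _ => l ^ k).sum := by simp; ring
      _ ≤ _ := List.sum_le_sum fun i _ => (ih _).trans (Nat.le_succ _)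

theorem count_flatMap_append_singleton [DecidableEq A] {ι : Type*} {c : A} {B : ι → List A}
    (hB : ∀ i, c ∉ B i) (Q : List ι) : (Q.flatMap fun i => B i ++ [c]).count c = Q.length := by
  induction Q with
  | nil => simp
  | cons i Q ih => simp [ih, List.count_eq_zero.2 (hB i)]

/-- If `w` spilled past `B i`, its first spilled letter, not being `c`, would skip the closer of `B
i`, leaving `Q.length` copies of `c` to match `Q.length + 1`. -/
theorem sublist_of_append_replicate_sublist {ι : Type*} {c : A} {B : ι → List A}
    (hB : ∀ i, c ∉ B i) {w : List A} (hw : c ∉ w) (i : ι) (Q : List ι)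
    (h : (w ++ List.replicate (Q.length + 1) c).Sublist
      (B i ++ c :: Q.flatMap fun i => B i ++ [c])) : w.Sublist (B i) := by
  classical
  obtain ⟨u, v, huv, hu, hv⟩ := List.sublist_append_iff.1 h
  rcases List.append_eq_append_iff.1 huv with ⟨r, rfl, hr⟩ | ⟨r, rfl, rfl⟩
  · exact (List.sublist_append_left w r).trans hu
  · cases r with
    | nil => simpa using hu
    | cons d r =>
      have hd : d ≠ c := by rintro rfl; simp at hw
      have hr : c ∉ r := fun h => hw (by simp [h])
      have hv' := (List.sublist_cons_iff.1 hv).resolve_right (by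
        rintro ⟨r', h, -⟩
        exact hd (by simpa using (List.cons.inj h).1))
      have := hv'.count_le c
      rw [count_flatMap_append_singleton hB] at this
      simp [List.count_cons_of_ne hd, List.count_eq_zero.2 hr] at this

/-- The blocks contain no `c`, so each leading `c` uses up at least one whole block of `P`. -/
theorem sublist_of_replicate_append_sublist {ι : Type*} {c : A} {B : ι → List A}
    (hB : ∀ i, c ∉ B i) {w : List A} (hw : c ∉ w) (i : ι) (P Q : List ι)
    (h : (List.replicate P.length c ++ (w ++ List.replicate (Q.length + 1) c)).Sublist
      ((P ++ i :: Q).flatMap fun i => B i ++ [c])) : w.Sublist (B i) := by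
  induction P with
  | nil => exact sublist_of_append_replicate_sublist hB hw i Q (by simpa using h)
  | cons p P ih =>
    refine ih ?_
    rw [List.length_cons, List.replicate_succ, List.cons_append, List.cons_append,
      List.flatMap_cons, List.append_assoc, List.singleton_append] at h
    obtain ⟨u, v, huv, hu, hv⟩ := List.sublist_append_iff.1 h
    cases u with
    | nil =>
      rw [List.nil_append] at huv
      rw [← huv] at hv
      exact List.cons_sublist_cons.1 hv
    | cons d u =>
      have := (List.cons.inj huv).1
      subst this
      exact absurd (hu.subset (by simp)) (hB p)

theorem replicate_sublist_flatMap {ι : Type*} (c : A) (B : ι → List A) (P : List ι) :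
    (List.replicate P.length c).Sublist (P.flatMap fun i => B i ++ [c]) := by
  induction P with
  | nil => simp
  | cons p P ih =>
    rw [List.length_cons, List.replicate_succ, List.flatMap_cons, ← List.singleton_append]
    exact (List.sublist_append_right _ _).append ih

theorem gridQuery_sublist_gridString_iff (f : ℕ → A) (l k : ℕ) (hf : Set.InjOn f (Set.Iic k))
    (T : (Fin k → Fin l) → Bool) (v : Fin k → Fin l) :
    (gridQuery f l k v).Sublist (gridString f l k T) ↔ T v = true := by
  induction k with
  | zero =>
    rw [Subsingleton.elim v Fin.elim0]
    unfold gridQuery gridString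
    split_ifs with h <;> simp [h]
  | succ k ih =>
    have hne : ∀ j ≤ k, f (k + 1) ≠ f j := fun j hj h => by
      have := hf (Set.mem_Iic.2 le_rfl) (Set.mem_Iic.2 (hj.trans k.le_succ)) h
      omega
    have hB : ∀ i : Fin l, f (k + 1) ∉ gridString f l k (fun v => T (Fin.cons i v)) := by
      intro i h
      obtain ⟨j, hj, h⟩ := mem_gridString f l k _ h
      exact hne j hj h
    have hw : f (k + 1) ∉ gridQuery f l k (Fin.tail v) := by
      intro h
      obtain ⟨j, hj, h⟩ := mem_gridQuery f l k _ h
      exact hne j hj h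
    have ih' := ih (hf.mono (Set.Iic_subset_Iic.2 k.le_succ)) (fun w => T (Fin.cons (v 0) w))
      (Fin.tail v)
    rw [Fin.cons_self_tail] at ih'
    rw [← ih']
    -- `P` and `Q` are the slices before and after slice `v 0`; the extra `1` is that slice's own
    -- closer.
    obtain ⟨P, Q, hPQ, hP, hQ⟩ : ∃ P Q : List (Fin l), List.finRange l = P ++ v 0 :: Q ∧
        P.length = v 0 ∧ Q.length + 1 = l - v 0 := by
      have hlt := (v 0).isLt
      refine ⟨(List.finRange l).take (v 0), (List.finRange l).drop (v 0 + 1), ?_, ?_, ?_⟩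
      · conv_lhs => rw [← List.take_append_drop (v 0 : ℕ) (List.finRange l)]
        rw [List.drop_eq_getElem_cons (by simp)]
        simp
      · simp [hlt.le]
      · simp; omega
    simp only [gridQuery, gridString, hPQ]
    rw [← hQ, ← hP]
    constructor
    · exact sublist_of_replicate_append_sublist hB hw (v 0) P Q
    · intro h
      rw [List.flatMap_append, List.flatMap_cons, List.append_assoc, List.replicate_succ,
        ← List.singleton_append]
      exact (replicate_sublist_flatMap _ _ P).append
        (h.append ((List.Sublist.refl _).append (replicate_sublist_flatMap _ _ Q)))

end Gadget

/-! ### The lower bound for the one-way communication of the index problem -/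

section Index

/-- The sum factors over coordinates, each contributing `1 + 1 / 2`. -/
theorem sum_two_inv_pow_card_ne {ι : Type*} [Fintype ι] [DecidableEq ι] (v : ι → Bool) :
    ∑ T : ι → Bool, (2⁻¹ : ℝ) ^ (Finset.univ.filter fun i => v i ≠ T i).card =
      (3 / 2) ^ Fintype.card ι := by
  have h : ∀ T : ι → Bool, (2⁻¹ : ℝ) ^ (Finset.univ.filter fun i => v i ≠ T i).card =
      ∏ i, if v i ≠ T i then (2⁻¹ : ℝ) else 1 := fun T => by
    rw [← Finset.prod_filter, Finset.prod_const]
  simp_rw [h]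
  rw [← Fintype.piFinset_univ,
    ← Finset.prod_univ_sum (fun _ => Finset.univ) fun i b => if v i ≠ b then (2⁻¹ : ℝ) else 1]
  rw [← Finset.card_univ, ← Finset.prod_const]
  refine Finset.prod_congr rfl fun i _ => ?_
  cases v i <;> norm_num

/-- If a map from bit vectors to the messages in `M` allows one to guess the bits with an
average error rate of at most `1 / 3`, then `M` has exponential size. -/
theorem pow_card_le_card_pow_of_sum_card_ne_le {ι β : Type*} [Fintype ι] [DecidableEq ι]
    (M : Finset β) (enc : (ι → Bool) → β) (henc : ∀ T, enc T ∈ M) (dec : β → ι → Bool)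
    (h : ∑ T : ι → Bool, ((Finset.univ.filter fun i => dec (enc T) i ≠ T i).card : ℝ) ≤
      2 ^ Fintype.card ι * (Fintype.card ι / 3)) :
    (32 / 27 : ℝ) ^ Fintype.card ι ≤ (M.card : ℝ) ^ 3 := by
  set m := Fintype.card ι with hm
  set d : (ι → Bool) → ℕ := fun T => (Finset.univ.filter fun i => dec (enc T) i ≠ T i).card
  -- `E = 2 ^ (-m / 3)` is the weight at the mean error count.
  set E : ℝ := Real.exp (-(Real.log 2 * (m / 3))) with hE
  have hlog : 0 ≤ Real.log 2 := Real.log_nonneg one_le_two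
  have hE3 : E ^ 3 = 2⁻¹ ^ m := by
    rw [hE, ← Real.exp_nat_mul, inv_pow, ← Real.exp_log (show (0 : ℝ) < 2 ^ m by positivity),
      ← Real.exp_neg, Real.log_pow]
    congr 1
    push_cast
    ring
  have hlow : 2 ^ m * E ≤ ∑ T, (2⁻¹ : ℝ) ^ d T := by
    -- The tangent line of `2 ^ (-d)` at `d = m / 3` lies below the curve, which gives Jensen's
    -- inequality after summing.
    have hT : ∀ T, E * (1 + Real.log 2 * (m / 3 - d T)) ≤ (2⁻¹ : ℝ) ^ d T := fun T => by
      have : (2⁻¹ : ℝ) ^ d T = E * Real.exp (Real.log 2 * (m / 3 - d T)) := by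
        rw [hE, ← Real.exp_add, inv_pow, ← Real.exp_log (show (0 : ℝ) < 2 ^ d T by positivity),
          ← Real.exp_neg, Real.log_pow]
        congr 1
        ring
      rw [this]
      gcongr
      linarith [Real.add_one_le_exp (Real.log 2 * (m / 3 - d T))]
    refine le_trans ?_ (Finset.sum_le_sum fun T _ => hT T)
    rw [← Finset.mul_sum, Finset.sum_add_distrib, ← Finset.mul_sum, Finset.sum_sub_distrib,
      mul_comm]
    have hc : (Fintype.card (ι → Bool) : ℝ) = 2 ^ m := by simp [hm]
    simp only [Finset.sum_const, Finset.card_univ, nsmul_eq_mul, hc, mul_one]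
    gcongr
    nlinarith
  have hup : ∑ T, (2⁻¹ : ℝ) ^ d T ≤ M.card * (3 / 2) ^ m := by
    calc ∑ T, (2⁻¹ : ℝ) ^ d T
        ≤ ∑ T, ∑ a ∈ M, (2⁻¹ : ℝ) ^ (Finset.univ.filter fun i => dec a i ≠ T i).card :=
          Finset.sum_le_sum fun T _ => Finset.single_le_sum
            (f := fun a => (2⁻¹ : ℝ) ^ (Finset.univ.filter fun i => dec a i ≠ T i).card)
            (fun _ _ => by positivity) (henc T)
      _ = M.card * (3 / 2) ^ m := by
          rw [Finset.sum_comm]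
          simp_rw [sum_two_inv_pow_card_ne]
          simp [hm]
  have h3 : (2 ^ m * E) ^ 3 ≤ (M.card * (3 / 2 : ℝ) ^ m) ^ 3 := by
    have := hlow.trans hup
    gcongr
  rw [mul_pow, mul_pow, hE3, ← pow_mul, ← pow_mul, mul_comm m 3, pow_mul, pow_mul,
    ← mul_pow] at h3
  have hpos : (0 : ℝ) < ((3 / 2) ^ 3) ^ m := by positivity
  rw [← div_le_iff₀ hpos, ← div_pow] at h3
  norm_num at h3 ⊢
  exact h3

theorem exists_finset_length_le (k : ℕ) :
    ∃ M : Finset (List Bool), (∀ a : List Bool, a.length ≤ k → a ∈ M) ∧ M.card ≤ 4 ^ k := by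
  classical
  refine ⟨(Finset.univ : Finset (Σ j : Fin (k + 1), List.Vector Bool j)).image
    fun p => p.2.toList, fun a ha => ?_, ?_⟩
  · exact Finset.mem_image.2 ⟨⟨⟨a.length, by omega⟩, ⟨a, rfl⟩⟩, Finset.mem_univ _, rfl⟩
  · refine Finset.card_image_le.trans ?_
    rw [Finset.card_univ, Fintype.card_sigma]
    simp only [card_vector, Fintype.card_bool]
    rw [Fin.sum_univ_eq_sum_range (fun j => 2 ^ j) (k + 1)]
    induction k with
    | zero => simp
    | succ k ih =>
      rw [Finset.sum_range_succ]
      have h1 : 2 ^ (k + 1) ≤ 2 * 4 ^ k := by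
        rw [pow_succ, mul_comm]
        gcongr
        norm_num
      have h2 : 4 ^ (k + 1) = 4 * 4 ^ k := by ring
      omega

/-- A nonnegative function is at most its mean somewhere outside any null set. The `B p` need not be
measurable, so measurable hulls of equal measure replace them. -/
theorem exists_null_compl_le_third {Ω κ : Type*} [MeasurableSpace Ω] (μ : Measure Ω)
    [IsProbabilityMeasure μ] [Fintype κ] (B : κ → Set Ω) (hB : ∀ p, μ (B p) ≤ 1 / 3)
    {N : Set Ω} (hN : μ N = 0) :
    ∃ ω ∉ N, ∑ p, (B p).indicator (fun _ => (1 : ℝ)) ω ≤ Fintype.card κ / 3 := by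
  obtain ⟨ω, hω, h⟩ := exists_notMem_null_le_lintegral (μ := μ)
    (f := fun ω => ∑ p, (toMeasurable μ (B p)).indicator (fun _ => (1 : ENNReal)) ω)
    (Finset.measurable_sum _ fun p _ =>
      measurable_const.indicator (measurableSet_toMeasurable μ (B p))).aemeasurable hN
  refine ⟨ω, hω, ?_⟩
  have hint : ∫⁻ ω, ∑ p, (toMeasurable μ (B p)).indicator (fun _ => (1 : ENNReal)) ω ∂μ ≤
      ENNReal.ofReal (Fintype.card κ / 3) := by
    rw [lintegral_finsetSum _ fun p _ =>
      measurable_const.indicator (measurableSet_toMeasurable μ (B p))]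
    calc _ = ∑ p, μ (B p) := Finset.sum_congr rfl fun p _ => by
          rw [lintegral_indicator_const (measurableSet_toMeasurable μ (B p)), one_mul,
            measure_toMeasurable]
      _ ≤ ∑ _ : κ, (1 / 3 : ENNReal) := Finset.sum_le_sum fun p _ => hB p
      _ = ENNReal.ofReal (Fintype.card κ / 3) := by
          rw [ENNReal.ofReal_div_of_pos (by norm_num), ENNReal.ofReal_natCast]
          simp [div_eq_mul_inv]
  have hle : ENNReal.ofReal (∑ p, (B p).indicator (fun _ => (1 : ℝ)) ω) ≤
      ENNReal.ofReal (Fintype.card κ / 3) := by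
    refine le_trans ?_ (h.trans hint)
    rw [ENNReal.ofReal_sum_of_nonneg fun p _ => Set.indicator_nonneg (fun _ _ => zero_le_one) _]
    refine Finset.sum_le_sum fun p _ => ?_
    by_cases hp : ω ∈ B p
    · simp [hp, subset_toMeasurable μ (B p) hp]
    · simp [hp]
  exact (ENNReal.ofReal_le_ofReal_iff (by positivity)).1 hle

variable {A Ω : Type*} [MeasurableSpace Ω]

/-- If all messages were almost surely shorter than `s`, one outcome would have only short messages
and few errors, contradicting the counting bound. -/
theorem RandomizedSketch.sizeAtLeast_of_index {ι : Type*} [Fintype ι] (μ : Measure Ω)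
    [IsProbabilityMeasure μ] (S : RandomizedSketch A Ω) {L : ℕ} {X : Set (List A)}
    (x : (ι → Bool) → List A) (hx : ∀ T, x T ∈ X) (y : ι → List A) (hy : ∀ i, (y i).length ≤ L)
    (hxy : ∀ T i, (y i).Sublist (x T) ↔ T i = true) (hS : S.IsCorrectOn μ L X) {s : ℝ}
    (hs : 30 * s ≤ Fintype.card ι) : S.SizeAtLeast μ X s := by
  classical
  by_contra hlen
  have hnull : μ (⋃ T, {ω | s ≤ ((S.encode ω (x T)).length : ℝ)}) = 0 := by
    refine measure_iUnion_null fun T => ?_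
    by_contra h
    exact hlen ⟨x T, hx T, pos_iff_ne_zero.2 h⟩
  obtain ⟨ω, hω, herr⟩ := exists_null_compl_le_third μ
    (fun p : (ι → Bool) × ι =>
      {ω | ¬ (S.decode ω (S.encode ω (x p.1)) (y p.2) = true ↔ (y p.2).Sublist (x p.1))})
    (fun p => hS _ (hx _) _ (hy _)) hnull
  simp only [Set.mem_iUnion, Set.mem_ofPred_eq, not_exists, not_le] at hω
  obtain ⟨T₀, -, hT₀⟩ := Finset.exists_max_image Finset.univ
    (fun T => (S.encode ω (x T)).length) Finset.univ_nonempty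
  set k := (S.encode ω (x T₀)).length
  obtain ⟨M, hM, hMcard⟩ := exists_finset_length_le k
  have hpow := pow_card_le_card_pow_of_sum_card_ne_le M (fun T : ι → Bool => S.encode ω (x T))
    (fun T => hM _ (hT₀ T (Finset.mem_univ T))) (fun a i => S.decode ω a (y i)) (by
      refine le_of_eq_of_le ?_ (herr.trans_eq ?_)
      · rw [Fintype.sum_prod_type]
        refine Finset.sum_congr rfl fun T _ => ?_
        rw [Finset.card_filter]
        push_cast
        refine Finset.sum_congr rfl fun i _ => ?_
        simp only [Set.indicator_apply, Set.mem_ofPred_eq, hxy, Bool.coe_iff_coe, ne_eq]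
      · simp; ring)
  set m := Fintype.card ι
  -- The constant is `30 = 5 * 3 * 2`: `2 ≤ (32 / 27) ^ 5`, the cube in `hpow`, and `4 = 2 ^ 2`.
  have h1 : (2 : ℝ) ^ m ≤ 2 ^ (30 * k) := by
    calc (2 : ℝ) ^ m ≤ ((32 / 27 : ℝ) ^ m) ^ 5 := by
          rw [← pow_mul, mul_comm, pow_mul]
          gcongr
          norm_num
      _ ≤ (((4 : ℝ) ^ k) ^ 3) ^ 5 := by
          refine pow_le_pow_left₀ (by positivity) (hpow.trans ?_) 5
          refine pow_le_pow_left₀ (by positivity) ?_ 3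
          exact_mod_cast hMcard
      _ = 2 ^ (30 * k) := by
          rw [show (4 : ℝ) = 2 ^ 2 by norm_num, ← pow_mul, ← pow_mul, ← pow_mul]
          ring_nf
  have h2 : m ≤ 30 * k := (pow_le_pow_iff_right₀ (by norm_num : (1 : ℝ) < 2)).1 h1
  have h3 : (m : ℝ) ≤ 30 * k := by exact_mod_cast h2
  have h4 := hω T₀
  change (k : ℝ) < s at h4
  linarith

end Index

/-- The index problem of size `m`, with `m` of order `L ^ (σ - 1)`, embeds into strings whose length
is within the bounds of the main theorem. -/
theorem exists_index_family {A : Type*} [Fintype A] {σ : ℕ} (hσ : 1 ≤ σ)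
    (hA : Fintype.card A = σ) {L : ℕ} (hL : 2 ≤ L) :
    ∃ (m : ℕ) (x : ((Fin m) → Bool) → List A) (y : Fin m → List A),
      (∀ T, 1 / (4 * σ : ℝ) ^ (σ - 1) * (L : ℝ) ^ (σ - 1) ≤ ((x T).length : ℝ) ∧
        ((x T).length : ℝ) ≤ 2 * σ * (L : ℝ) ^ (σ - 1)) ∧
      (∀ i, (y i).length ≤ L) ∧ (∀ T i, (y i).Sublist (x T) ↔ T i = true) ∧
      1 / (4 * σ : ℝ) ^ (σ - 1) * (L : ℝ) ^ (σ - 1) ≤ m := by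
  obtain ⟨k, rfl⟩ : ∃ k, σ = k + 1 := ⟨σ - 1, by omega⟩
  rw [Nat.add_sub_cancel, one_div_mul_eq_div, ← div_pow]
  obtain ⟨e⟩ : Nonempty (Fin (k + 1) ≃ A) := ⟨(Fintype.equivFinOfCardEq hA).symm⟩
  have hLR : (2 : ℝ) ≤ L := by exact_mod_cast hL
  -- Here there is no dimension or no room for a side `l ≥ 1`, but the target is at most `1`, so one
  -- bit suffices. The query has length `2`, hence `2 ≤ L`.
  by_cases hk : k = 0 ∨ L ≤ k
  · have hone : ((L : ℝ) / (4 * (k + 1 : ℕ))) ^ k ≤ 1 := by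
      rcases hk with rfl | hk
      · simp
      · refine pow_le_one₀ (by positivity) ?_
        have : (L : ℝ) ≤ k := by exact_mod_cast hk
        rw [div_le_one (by positivity)]
        push_cast
        linarith [(Nat.cast_nonneg k : (0 : ℝ) ≤ k)]
    have hLk : (1 : ℝ) ≤ (L : ℝ) ^ k := one_le_pow₀ (by linarith)
    have hb : (2 : ℝ) ≤ 2 * (k + 1 : ℕ) * (L : ℝ) ^ k := by
      have : (1 : ℝ) ≤ (k + 1 : ℕ) := by exact_mod_cast Nat.le_add_left 1 k
      nlinarith
    refine ⟨1, fun T => if T 0 then [e 0, e 0] else [e 0], fun _ => [e 0, e 0], fun T => ?_,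
      fun _ => hL, fun T i => ?_, by simpa using hone⟩
    · dsimp only
      split_ifs
      · exact ⟨hone.trans (by simp), hb.trans' (by simp)⟩
      · exact ⟨hone.trans (by simp), hb.trans' (by simp)⟩
    · rw [Subsingleton.elim i 0]
      dsimp only
      split_ifs with h <;> simp [h]
  · push Not at hk
    obtain ⟨hk0, hkL⟩ := hk
    -- The largest side with query length `k * l + 1 ≤ L`.
    set l := (L - 1) / k
    have hkpos : 0 < k := Nat.pos_of_ne_zero hk0
    have hl : 1 ≤ l := (Nat.one_le_div_iff hkpos).2 (by omega)
    have hkl : k * l ≤ L - 1 := Nat.mul_div_le _ _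
    have hlL : l ≤ L := (Nat.div_le_self _ _).trans (Nat.sub_le _ _)
    -- Since `l ≥ 1`, rounding costs at most a factor two: `L ≤ k * l + k ≤ 2 * k * l`.
    have hlow : (L : ℝ) / (4 * (k + 1 : ℕ)) ≤ l := by
      have h : L - 1 < k * (l + 1) := Nat.lt_mul_div_succ _ hkpos
      have h' : L ≤ k * l + k := by rw [mul_add, mul_one] at h; omega
      have h'' : (L : ℝ) ≤ k * l + k := by exact_mod_cast h'
      have hl' : (1 : ℝ) ≤ l := by exact_mod_cast hl
      have hk' : (0 : ℝ) ≤ k := Nat.cast_nonneg k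
      rw [div_le_iff₀ (by positivity)]
      push_cast
      nlinarith
    have hlowk : ((L : ℝ) / (4 * (k + 1 : ℕ))) ^ k ≤ (l : ℝ) ^ k :=
      pow_le_pow_left₀ (by positivity) hlow k
    let g : Fin (l ^ k) ≃ (Fin k → Fin l) := finFunctionFinEquiv.symm
    let f : ℕ → A := fun j => e (Fin.ofNat (k + 1) j)
    have hf : Set.InjOn f (Set.Iic k) := fun i hi j hj h => by
      have h := congrArg Fin.val (e.injective h)
      simp only [Fin.val_ofNat] at h
      rwa [Nat.mod_eq_of_lt (Nat.lt_succ_of_le hi), Nat.mod_eq_of_lt (Nat.lt_succ_of_le hj)] at h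
    refine ⟨l ^ k, fun T => gridString f l k (T ∘ g.symm), fun i => gridQuery f l k (g i),
      fun T => ⟨hlowk.trans ?_, ?_⟩, fun i => ?_, fun T i => ?_, by exact_mod_cast hlowk⟩
    · exact_mod_cast pow_le_length_gridString f l k hkpos _
    · have h1 : (k + 1) * l ^ k ≤ 2 * (k + 1) * L ^ k :=
        Nat.mul_le_mul (by omega) (Nat.pow_le_pow_left hlL k)
      exact_mod_cast (length_gridString_le f l k _).trans h1
    · rw [length_gridQuery]
      omega
    · rw [gridQuery_sublist_gridString_iff f l k hf]
      simp

theorem mainTheorem5 (σ : ℕ) (hσ : 1 ≤ σ) :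
    ∃ c a b : ℝ, 0 < c ∧ 0 < a ∧ a ≤ b ∧
      ∀ (A : Type*) [Fintype A], Fintype.card A = σ →
      ∀ (Ω : Type*) [MeasurableSpace Ω] (μ : Measure Ω) [IsProbabilityMeasure μ]
        (S : RandomizedSketch A Ω) (L : ℕ), 2 ≤ L →
        (S.IsCorrectOn μ L Set.univ →
          S.SizeAtLeast μ Set.univ (c * (L : ℝ) ^ (σ - 1))) ∧
        (S.IsCorrectOn μ L {x : List A | a * (L : ℝ) ^ (σ - 1) ≤ (x.length : ℝ) ∧
            (x.length : ℝ) ≤ b * (L : ℝ) ^ (σ - 1)} →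
          S.SizeAtLeast μ {x : List A | a * (L : ℝ) ^ (σ - 1) ≤ (x.length : ℝ) ∧
            (x.length : ℝ) ≤ b * (L : ℝ) ^ (σ - 1)} (c * (L : ℝ) ^ (σ - 1))) := by
  have hσ' : (1 : ℝ) ≤ σ := by exact_mod_cast hσ
  have ha : (0 : ℝ) < 1 / (4 * σ : ℝ) ^ (σ - 1) := by positivity
  have hab : 1 / (4 * σ : ℝ) ^ (σ - 1) ≤ 2 * σ := by
    calc 1 / (4 * σ : ℝ) ^ (σ - 1) ≤ 1 :=
          div_le_one_of_le₀ (one_le_pow₀ (by linarith)) (by positivity)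
      _ ≤ 2 * σ := by linarith
  refine ⟨1 / (4 * σ : ℝ) ^ (σ - 1) / 30, 1 / (4 * σ : ℝ) ^ (σ - 1), 2 * σ, by positivity, ha, hab,
    fun A _ hA Ω _ μ _ S L hL => ?_⟩
  obtain ⟨m, x, y, hx, hy, hxy, hm⟩ := exists_index_family hσ hA hL
  have hs : 30 * (1 / (4 * σ : ℝ) ^ (σ - 1) / 30 * (L : ℝ) ^ (σ - 1)) ≤ Fintype.card (Fin m) := by
    rw [Fintype.card_fin]
    linarith
  exact ⟨fun hS => S.sizeAtLeast_of_index μ x (fun _ => Set.mem_univ _) y hy hxy hS hs,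
    fun hS => S.sizeAtLeast_of_index μ x hx y hy hxy hS hs⟩
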